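/- \textbf{Conventions.} Let $r,s\ge 0$ be integers. \emph{Formal commutators} in letters $x_1,\dots,x_r$ are defined recursively: each $x_i$ and each $x_i^{-1}$ is a formal commutator, and if $\alpha,\beta$ are formal commutators then so is $[\alpha,\beta]$. Given elements $x_1,\dots,x_r$ of a group, formal commutators are interpreted there via $[a,b]=a^{-1}b^{-1}ab$. The weight vector $\chi(\alpha)\in\mathbb{Z}_{\ge0}^r$ is given by $\chi(x_i^{\pm1})=e_i$ (the $i$th unit vector) and $\chi([\alpha,\beta])=\chi(\alpha)+\chi(\beta)$; the total weight of $\alpha$ is $\sum_i\chi_i(\alpha)$. \emph{Basic commutators} $u_1,u_2,\dots$ are defined and ordered recursively: those of total weight $1$ are $u_i=x_i$ for $i=1,\dots,r$, in this order; once those of total weight less than $k$ have been listed, a formal commutator of total weight $k$ is basic if it is $[u_i,u_j]$ with $i>j$ and, in case $u_i=[u_p,u_t]$, also $j\ge t$. Those of total weight $k$ are listed after all those of smaller total weight, in any order in which basic commutators with the same weight vector are consecutive. Let $u_1,\dots,u_d$ be any such complete list of the basic commutators of total weight at most $s$. A group is called $s$-step nilpotent if its nilpotency class is at most $s$. For elements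 $v_1,\dots,v_d$ of a group and real $M_1,\dots,M_d\ge0$ write $P_{\rm ord}(v;M)=\{v_1^{\ell_1}\cdots v_d^{\ell_d}:\ell_i\in\mathbb{Z},\ |\ell_i|\le M_i\}$. For $C>0$ and $M_1,\dots,M_d>0$, the tuple $(v;M)$ is in \emph{$C$-upper-triangular form} if for all $1\le i<j\le d$ and all four choices of signs $$[v_i^{\pm1},v_j^{\pm1}]\in P_{\rm ord}\Bigl(v_{j+1},\dots,v_d;\tfrac{CM_{j+1}}{M_iM_j},\dots,\tfrac{CM_d}{M_iM_j}\Bigr).$$ A \emph{nilpotent progression} of rank $r$ and step $s$, on elements $x_1,\dots,x_r$ of an $s$-step nilpotent group and with positive integer lengths $L_1,\dots,L_r$, is $P_{\rm ord}(u;M)$, where $u_1,\dots,u_d$ is such a list, interpreted in the group, and $M_i=\prod_{a=1}^rL_a^{\chi_a(u_i)}$ for $1\le i\le d$. It is said to be in $C$-upper-triangular form if the tuple $(u;M)$ is. \textbf{Theorem.} (1) For all $r,s$ there is a constant $C=C_{r,s}>0$, depending only on $r$ and $s$, such that every nilpotent progression of rank $r$ and step $s$ is in $C$-upper-triangular form.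 (2) Let $G$ be the free $s$-step nilpotent group on $x_1,\dots,x_r$, let $u_1,\dots,u_d$ be a complete list of basic commutators of total weight at most $s$ as above, and let $\alpha$ be any (not necessarily basic) formal commutator in the $x_i$. Then $\alpha$ has in $G$ a unique expression $\alpha=u_1^{\ell_1}\cdots u_d^{\ell_d}$ with $\ell_i\in\mathbb{Z}$, and every $u_i$ with $\ell_i\ne0$ satisfies $\chi(u_i)\ge\chi(\alpha)$ coordinatewise. -/

import Mathlib

namespace NilProg

/-- Formal commutators in the letters `x_1, …, x_r` (indexed by `Fin r`): the letters, their formal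
inverses, and formal brackets `[α, β]`. -/
inductive FormalComm (r : ℕ) : Type
  | letter (i : Fin r) : FormalComm r
  | letterInv (i : Fin r) : FormalComm r
  | bracket (α β : FormalComm r) : FormalComm r

/-- The group commutator in the convention `[a, b] = a⁻¹ b⁻¹ a b`. -/
def comm {G : Type*} [Group G] (a b : G) : G := a⁻¹ * b⁻¹ * a * b

namespace FormalComm

variable {r : ℕ}

/-- The weight vector `χ(α)`. -/
def weight : FormalComm r → Fin r → ℕ
  | letter j => fun i => if i = j then 1 else 0
  | letterInv j => fun i => if i = j then 1 else 0
  | bracket α β => fun i => weight α i + weight β i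

/-- The total weight `|χ(α)|`. -/
def totalWeight (α : FormalComm r) : ℕ := ∑ i, α.weight i

/-- The interpretation of a formal commutator in a group, the letters being interpreted as the
elements `x i`. -/
def eval {G : Type*} [Group G] (x : Fin r → G) : FormalComm r → G
  | letter i => x i
  | letterInv i => (x i)⁻¹
  | bracket α β => comm (eval x α) (eval x β)

end FormalComm

open FormalComm in
/-- `u_1, …, u_d` (here `u 0, …, u (d - 1)`) is a complete ordered list of the basic commutators of
total weight at most `s` in the letters `x_1, …, x_r`. -/
structure IsBasicCommList (r s : ℕ) {d : ℕ} (u : Fin d → FormalComm r) : Prop where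
  /-- There are no repetitions. -/
  injective : Function.Injective u
  /-- The entries of the list are exactly the letters, and the brackets `[u_i, u_j]` with `j < i`
  for which `t ≤ j` whenever `u_i = [u_p, u_t]`, restricted to total weight at most `s`. -/
  mem_iff : ∀ α : FormalComm r, α ∈ Set.range u ↔
    α.totalWeight ≤ s ∧
      ((∃ a, α = letter a) ∨
        ∃ i j, α = bracket (u i) (u j) ∧ j < i ∧
          ∀ p t, u i = bracket (u p) (u t) → t ≤ j)
  /-- The list is ordered by total weight. -/
  totalWeight_mono : ∀ i j, i ≤ j → (u i).totalWeight ≤ (u j).totalWeight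
  /-- The letters are listed in the order `x_1, …, x_r`. -/
  letters_mono : ∀ i j a b, u i = letter a → u j = letter b → a < b → i < j
  /-- Basic commutators with the same weight vector are consecutive. -/
  consecutive : ∀ i j k, i ≤ j → j ≤ k → (u i).weight = (u k).weight → (u j).weight = (u i).weight

/-- The ordered product `u_1 ^ ℓ_1 * ⋯ * u_d ^ ℓ_d`. -/
def orderedProd {G : Type*} [Group G] {d : ℕ} (u : Fin d → G) (l : Fin d → ℤ) : G :=
  (List.ofFn fun i => u i ^ l i).prod

/-- The ordered progression `P_ord(u; L) = {u_1 ^ ℓ_1 * ⋯ * u_d ^ ℓ_d : |ℓ_i| ≤ L_i}`. -/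
def ordProg {G : Type*} [Group G] {d : ℕ} (u : Fin d → G) (L : Fin d → ℝ) : Set G :=
  {g | ∃ l : Fin d → ℤ, (∀ i, |(l i : ℝ)| ≤ L i) ∧ g = orderedProd u l}

/-- The tail `v_{j+1}, …, v_d` of a tuple `v_1, …, v_d`. -/
def tailAfter {X : Type*} {d : ℕ} (v : Fin d → X) (j : Fin d) : Fin (d - (j.val + 1)) → X :=
  fun k => v ⟨j.val + 1 + k.val, by have := k.isLt; omega⟩

/-- The tuple `(u; L)` is in `C`-upper-triangular form: for all `i < j` and all four choices of
signs, `[u_i^{±1}, u_j^{±1}]` lies in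
`P_ord(u_{j+1}, …, u_d; C L_{j+1} / (L_i L_j), …, C L_d / (L_i L_j))`. -/
def IsUpperTriangular {G : Type*} [Group G] {d : ℕ} (C : ℝ) (u : Fin d → G) (L : Fin d → ℝ) :
    Prop :=
  ∀ i j : Fin d, i < j → ∀ a ∈ ({u i, (u i)⁻¹} : Set G), ∀ b ∈ ({u j, (u j)⁻¹} : Set G),
    comm a b ∈ ordProg (tailAfter u j) (tailAfter (fun k => C * L k / (L i * L j)) j)

/-- The length `L^χ(α) = L_1 ^ χ_1(α) * ⋯ * L_r ^ χ_r(α)`. -/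
def nilLength {r : ℕ} (L : Fin r → ℕ) (α : FormalComm r) : ℝ := ∏ a, (L a : ℝ) ^ α.weight a

/-- `G` is `s`-step nilpotent: its lower central series `γ_1 = G, γ_2 = [G, G], …` satisfies
`γ_{s+1} = 1` (Mathlib indexes this series from `0`). -/
def IsStepNilpotent (s : ℕ) (G : Type*) [Group G] : Prop :=
  (⊤ : Subgroup G).lowerCentralSeries s = ⊥

/-- The free `s`-step nilpotent group on `r` generators. -/
abbrev FreeNilpotent (r s : ℕ) : Type :=
  FreeGroup (Fin r) ⧸ (⊤ : Subgroup (FreeGroup (Fin r))).lowerCentralSeries s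

/-- The generators `x_1, …, x_r` of the free `s`-step nilpotent group. -/
def FreeNilpotent.gen (r s : ℕ) (i : Fin r) : FreeNilpotent r s :=
  QuotientGroup.mk (FreeGroup.of i)

end NilProg

/-!
Both parts follow from Lazard elimination, carried out on groups.

Let `H` be the free group on generators indexed by the list `u_0, …, u_(d-1)`. At stage `j`, after
the elimination of `u_0, …, u_(j-1)`, the relevant generators are the free letters: the `u_i` with
`i ≥ j` that are letters `x_a` or brackets `[u_p, u_t]` with `t < j`. Let `u_j` act on the next
free group by the automorphism `u_i ↦ u_i [u_i, u_j]`, where `[u_i, u_j]` is read as a generator if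
it is in the list and as `1` otherwise. Sending `u_j` to the generator of `ℤ` maps `H` to the
semidirect product `H ⋊ ℤ` for this action (`elim`). In it the commutator of `u_i` and `u_j` is the
generator `[u_i, u_j]` again, and Hall's condition on basic commutators says exactly that these
brackets are the letters that the next stage needs (`isFreeLetter_of_bracket`,
`totalWeight_lt_of_bracketIndex`).

Weights are controlled by the smallest filtration of `H` that is compatible with commutators and in
which every generator has its own weight (`weightSubgroup`). The automorphism is trivial modulo
higher weight, by the weight of `u_j`, so `H ⋊ ℤ` carries a filtration whose `m`-th term involves
`u_j` only if `m` is at most the weight of `u_j` (`isFiltration_semidirectFiltration`,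
`elim_of_mem`). This works for weights in any canonically ordered monoid. It is used twice.

With weight vectors, elimination gives existence: an element of weight `χ` equals `u_j ^ a` times
an element of weight `χ` at the next stage, with `a ≠ 0` only if `χ ≤ χ(u_j)`; and the image in an
`s`-step nilpotent group respects this, since brackets missing from the list are trivial there
(`elimEval_eq_of_elim_eq`, `exists_elimEval_eq_tailProd`). Repeating this for all `j` gives the
ordered product with the exponents supported on weights `≥ χ`.

With total weights, elimination gives uniqueness: it maps `u_j ^ l_j ⋯ u_(d-1) ^ l_(d-1)` to the
power `l_j` of the generator of `ℤ` times the remaining ordered product at the next stage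
(`elim_tailProd`), and in total weight `s + 1` the factor `ℤ` does not occur. So the exponents can
be read off one after the other (`exponents_eq_of_tailProd`).

For the upper-triangular form, `[u_i^{±1}, u_j^{±1}]` has weight `χ(u_i) + χ(u_j)`, so it is an
ordered product of the `u_k` with `χ(u_k) ≥ χ(u_i) + χ(u_j)`. These have `k > j` and
`M_k ≥ M_i M_j`, and the exponents depend only on the list; as there are only finitely many lists
(`finite_isBasicCommList`), a bound for all these exponents serves as `C`.
-/

namespace NilProg

open scoped commutatorElement

/-! ### Filtrations indexed by weights -/

/-- A filtration of a group by subgroups indexed by an ordered monoid of weights, compatible with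
commutators. As `F 0` is the whole group, every `F m` is normal. -/
structure IsFiltration {M G : Type*} [AddCommMonoid M] [PartialOrder M] [Group G]
    (F : M → Subgroup G) : Prop where
  zero : F 0 = ⊤
  antitone : Antitone F
  commutator_mem : ∀ {m n : M} {g h : G}, g ∈ F m → h ∈ F n → ⁅g, h⁆ ∈ F (m + n)

namespace IsFiltration

variable {M G Q : Type*} [AddCommMonoid M] [PartialOrder M] [Group G] [Group Q]
  {F : M → Subgroup G}

theorem normal (hF : IsFiltration F) (m : M) : (F m).Normal := by
  refine Subgroup.commutator_top_left_le_iff.mp (Subgroup.commutator_le.mpr fun g _ h hh => ?_)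
  have := hF.commutator_mem (m := 0) (g := g) (by rw [hF.zero]; trivial) hh
  rwa [zero_add] at this

theorem conj_mem (hF : IsFiltration F) {m : M} {g : G} (hg : g ∈ F m) (h : G) :
    h * g * h⁻¹ ∈ F m :=
  (hF.normal m).conj_mem g hg h

theorem comm_mem (hF : IsFiltration F) {m n : M} {g h : G} (hg : g ∈ F m) (hh : h ∈ F n) :
    comm g h ∈ F (m + n) := by
  have := hF.commutator_mem (inv_mem hg) (inv_mem hh)
  simpa [comm, commutatorElement_def] using this

theorem comap {F : M → Subgroup Q} (hF : IsFiltration F) (f : G →* Q) :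
    IsFiltration fun m => (F m).comap f where
  zero := by simp [hF.zero]
  antitone := fun _ _ h => Subgroup.comap_mono (hF.antitone h)
  commutator_mem := fun hg hh => by
    rw [Subgroup.mem_comap, map_commutatorElement]
    exact hF.commutator_mem hg hh

end IsFiltration

/-- The smallest filtration of a free group whose `m`-th term contains each generator of
weight `m`. -/
def weightSubgroup {M ι : Type*} [AddCommMonoid M] [PartialOrder M] (w : ι → M) (m : M) :
    Subgroup (FreeGroup ι) :=
  sInf {K | ∃ F : M → Subgroup (FreeGroup ι),
    IsFiltration F ∧ (∀ i, FreeGroup.of i ∈ F (w i)) ∧ K = F m}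

section WeightSubgroup

variable {M ι : Type*} [AddCommMonoid M] [PartialOrder M] {w : ι → M}

theorem mem_weightSubgroup {m : M} {g : FreeGroup ι} :
    g ∈ weightSubgroup w m ↔ ∀ F : M → Subgroup (FreeGroup ι), IsFiltration F →
      (∀ i, FreeGroup.of i ∈ F (w i)) → g ∈ F m := by
  rw [weightSubgroup, Subgroup.mem_sInf]
  constructor
  · intro h F hF hw
    exact h _ ⟨F, hF, hw, rfl⟩
  · rintro h _ ⟨F, hF, hw, rfl⟩
    exact h F hF hw

theorem of_mem_weightSubgroup (i : ι) : FreeGroup.of i ∈ weightSubgroup w (w i) :=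
  mem_weightSubgroup.mpr fun _ _ hw => hw i

theorem isFiltration_weightSubgroup : IsFiltration (weightSubgroup w) where
  zero := by
    rw [eq_top_iff]
    intro g _
    rw [mem_weightSubgroup]
    intro F hF _
    rw [hF.zero]
    trivial
  antitone := fun m n h g hg => by
    rw [mem_weightSubgroup] at hg ⊢
    exact fun F hF hw => hF.antitone h (hg F hF hw)
  commutator_mem := fun hg hh => by
    rw [mem_weightSubgroup] at hg hh ⊢
    exact fun F hF hw => hF.commutator_mem (hg F hF hw) (hh F hF hw)

/-- The universal property of `weightSubgroup`. -/
theorem map_mem_of_mem_weightSubgroup {Q : Type*} [Group Q] {F : M → Subgroup Q}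
    (hF : IsFiltration F) (f : FreeGroup ι →* Q) (hf : ∀ i, f (FreeGroup.of i) ∈ F (w i))
    {m : M} {g : FreeGroup ι} (hg : g ∈ weightSubgroup w m) : f g ∈ F m :=
  mem_weightSubgroup.mp hg _ (hF.comap f) hf

theorem eq_top_of_forall_of_mem {K : Subgroup (FreeGroup ι)}
    (h : ∀ i, FreeGroup.of i ∈ K) : K = ⊤ := by
  rw [eq_top_iff, ← FreeGroup.closure_range_of, Subgroup.closure_le]
  rintro _ ⟨i, rfl⟩
  exact h i

theorem weightSubgroup_eq_top {m : M} (h : ∀ i, m ≤ w i) : weightSubgroup w m = ⊤ :=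
  eq_top_of_forall_of_mem fun i =>
    isFiltration_weightSubgroup.antitone (h i) (of_mem_weightSubgroup i)

end WeightSubgroup

/-- `f` raises weights by at least `c`, in the sense that `f g = g` modulo terms of weight
`m + c` whenever `g` has weight `m`. -/
def IsShear {M G : Type*} [AddCommMonoid M] [Group G] (F : M → Subgroup G) (c : M)
    (f : G → G) : Prop :=
  ∀ ⦃m : M⦄ ⦃g : G⦄, g ∈ F m → g⁻¹ * f g ∈ F (m + c)

section Shear

variable {M : Type*} [AddCommMonoid M] [PartialOrder M] [IsOrderedAddMonoid M]
  [CanonicallyOrderedAdd M]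

theorem IsShear.map_mem {G : Type*} [Group G] {F : M → Subgroup G} (hF : IsFiltration F) {c : M}
    {f : G → G} (hf : IsShear F c f) {m : M} {g : G} (hg : g ∈ F m) : f g ∈ F m := by
  have h := mul_mem hg (hF.antitone (le_add_of_nonneg_right (zero_le)) (hf hg))
  rwa [mul_inv_cancel_left] at h

/-- Whether an endomorphism of a free group is a shear may be tested on generators: the elements
that it shears form themselves a filtration. -/
theorem isShear_of_generators {ι : Type*} {w : ι → M} {c : M} (f : FreeGroup ι →* FreeGroup ι)
    (hf : ∀ i, (FreeGroup.of i)⁻¹ * f (FreeGroup.of i) ∈ weightSubgroup w (w i + c)) :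
    IsShear (weightSubgroup w) c f := by
  have hW : IsFiltration (weightSubgroup w) := isFiltration_weightSubgroup
  let F : M → Subgroup (FreeGroup ι) := fun m =>
    { carrier := {g | g ∈ weightSubgroup w m ∧ g⁻¹ * f g ∈ weightSubgroup w (m + c)}
      one_mem' := by simp [one_mem]
      mul_mem' := by
        rintro g h ⟨hg, hg'⟩ ⟨hh, hh'⟩
        refine ⟨mul_mem hg hh, ?_⟩
        have := mul_mem (hW.conj_mem hg' h⁻¹) hh'
        rw [map_mul]
        convert this using 1
        group
      inv_mem' := by
        rintro g ⟨hg, hg'⟩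
        refine ⟨inv_mem hg, ?_⟩
        have := hW.conj_mem (inv_mem hg') g
        rw [map_inv]
        convert this using 1
        group }
  have hF : IsFiltration F :=
    { zero := eq_top_of_forall_of_mem fun i =>
        ⟨by rw [hW.zero]; trivial, hW.antitone (by gcongr; exact zero_le) (hf i)⟩
      antitone := fun m n hmn g hg =>
        ⟨hW.antitone hmn hg.1, hW.antitone (by gcongr) hg.2⟩
      commutator_mem := by
        rintro m n g h ⟨hg, hg'⟩ ⟨hh, hh'⟩
        refine ⟨hW.commutator_mem hg hh, ?_⟩
        -- Modulo weight `m + n + c`, the errors in `f g` and `f h` drop out of the commutator.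
        have := hW.normal (m + n + c)
        let π := QuotientGroup.mk' (weightSubgroup w (m + n + c))
        have key : ∀ {a b : FreeGroup ι} {p q : M}, a ∈ weightSubgroup w p →
            b ∈ weightSubgroup w q → m + n + c ≤ p + q → Commute (π a) (π b) := by
          intro a b p q ha hb hpq
          rw [← commutatorElement_eq_one_iff_commute, ← map_commutatorElement]
          exact (QuotientGroup.eq_one_iff _).mpr
            (hW.antitone hpq (hW.commutator_mem ha hb))
        obtain ⟨a, ha⟩ : ∃ a, a = g⁻¹ * f g := ⟨_, rfl⟩
        obtain ⟨b, hb⟩ : ∃ b, b = h⁻¹ * f h := ⟨_, rfl⟩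
        rw [← ha] at hg'
        rw [← hb] at hh'
        have fg : f g = g * a := by rw [ha, mul_inv_cancel_left]
        have fh : f h = h * b := by rw [hb, mul_inv_cancel_left]
        have hfh : h * b ∈ weightSubgroup w n :=
          mul_mem hh (hW.antitone (le_add_of_nonneg_right (zero_le)) hh')
        have h1 : Commute (π a) (π (h * b)) := key hg' hfh (le_of_eq (by abel))
        have h2 : Commute (π g) (π b) := key hg hh' (le_of_eq (by abel))
        rw [map_commutatorElement, fg, fh]
        refine (QuotientGroup.eq_one_iff _).mp ?_
        change π (⁅g, h⁆⁻¹ * ⁅g * a, h * b⁆) = 1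
        rw [map_mul, map_inv, inv_mul_eq_one, map_commutatorElement, map_commutatorElement,
          map_mul π g a, commutatorElement_mul_left_eq_conj_mul, h1.commutator_eq, map_mul,
          commutatorElement_mul_right_eq_mul_conj, h2.commutator_eq]
        group }
  intro m g hg
  exact (mem_weightSubgroup.mp hg F hF fun i => ⟨of_mem_weightSubgroup i, hf i⟩).2

theorem IsShear.zpow {G : Type*} [Group G] {F : M → Subgroup G} (hF : IsFiltration F) {c : M}
    {σ : MulAut G} (h : IsShear F c σ) (h' : IsShear F c (σ⁻¹ : MulAut G)) (k : ℤ) :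
    IsShear F c (σ ^ k : MulAut G) := by
  have hmul : ∀ a b : MulAut G, IsShear F c a → IsShear F c b →
      IsShear F c (a * b : MulAut G) := by
    intro a b ha hb m g hg
    have := mul_mem (ha hg) (ha.map_mem hF (hb hg))
    rw [map_mul, map_inv] at this
    simpa [mul_assoc] using this
  let K : Subgroup (MulAut G) :=
    { carrier := {a | IsShear F c a ∧ IsShear F c (a⁻¹ : MulAut G)}
      one_mem' := ⟨fun m g _ => by simp [one_mem], fun m g _ => by simp [one_mem]⟩
      mul_mem' := fun {a b} ha hb =>
        ⟨hmul a b ha.1 hb.1, by rw [mul_inv_rev]; exact hmul _ _ hb.2 ha.2⟩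
      inv_mem' := fun {a} ha => ⟨ha.2, by rw [inv_inv]; exact ha.1⟩ }
  exact (K.zpow_mem (show σ ∈ K from ⟨h, h'⟩) k).1

/-- Adjoining to a filtered group an element of weight `c` that acts by a shear: `k ≠ 1` in the
second factor is allowed only in weights up to `c`. -/
def semidirectFiltration {G A : Type*} [Group G] [CommGroup A] {F : M → Subgroup G}
    (hF : IsFiltration F) {c : M} {φ : A →* MulAut G} (hφ : ∀ k, IsShear F c (φ k)) (m : M) :
    Subgroup (G ⋊[φ] A) where
  carrier := {x | x.left ∈ F m ∧ (x.right ≠ 1 → m ≤ c)}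
  one_mem' := by simp [one_mem]
  mul_mem' := by
    rintro x y ⟨hx, hx'⟩ ⟨hy, hy'⟩
    refine ⟨mul_mem hx ((hφ _).map_mem hF hy), fun h => ?_⟩
    by_cases h1 : x.right = 1
    · exact hy' fun h2 => h (by simp [h1, h2])
    · exact hx' h1
  inv_mem' := by
    rintro x ⟨hx, hx'⟩
    exact ⟨(hφ _).map_mem hF (inv_mem hx), fun h => hx' fun h1 => h (by simp [h1])⟩

theorem isFiltration_semidirectFiltration {G A : Type*} [Group G] [CommGroup A]
    {F : M → Subgroup G} (hF : IsFiltration F) {c : M} {φ : A →* MulAut G}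
    (hφ : ∀ k, IsShear F c (φ k)) : IsFiltration (semidirectFiltration hF hφ) where
  zero := by
    rw [eq_top_iff]
    intro x _
    exact ⟨by rw [hF.zero]; trivial, fun _ => zero_le⟩
  antitone := fun m n h x hx => ⟨hF.antitone h hx.1, fun h1 => h.trans (hx.2 h1)⟩
  commutator_mem := by
    rintro m n x y ⟨hx, hx'⟩ ⟨hy, hy'⟩
    have key : ∀ {p q : M} {g : G} {k : A}, g ∈ F p → (k ≠ 1 → q ≤ c) →
        g⁻¹ * φ k g ∈ F (p + q) := by
      intro p q g k hg hk
      by_cases h : k = 1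
      · simp [h, one_mem]
      · exact hF.antitone (by gcongr; exact hk h) (hφ k hg)
    have ha := key hy hx'
    have hb := key hx hy'
    rw [add_comm] at ha
    have hr : ⁅x, y⁆.right = 1 := by
      simp [commutatorElement_def]
    refine ⟨?_, fun h => absurd hr h⟩
    have hl : ⁅x, y⁆.left = x.left * φ x.right y.left * (φ y.right x.left)⁻¹ * y.left⁻¹ := by
      have h1 : ⁅x, y⁆ * (y * x) = x * y := by simp [commutatorElement_def, mul_assoc]
      have h2 := congrArg SemidirectProduct.left h1
      rw [SemidirectProduct.mul_left, hr, map_one] at h2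
      simp only [SemidirectProduct.mul_left, MulAut.one_apply] at h2
      rw [eq_mul_inv_of_mul_eq h2]
      group
    rw [hl]
    have := mul_mem (hF.conj_mem (mul_mem ha (inv_mem hb)) (x.left * y.left))
      (hF.commutator_mem hx hy)
    convert this using 1
    rw [commutatorElement_def]
    group

end Shear

/-! ### The lower central series as a filtration -/

/-- With the series `γ_1, γ_2, …` indexed from `1`, this is `[γ_(m+1), γ_(n+1)] ≤ γ_(m+n+2)`. -/
theorem commutator_lowerCentralSeries_le {G : Type*} [Group G] (n : ℕ) : ∀ m : ℕ,
    ⁅(⊤ : Subgroup G).lowerCentralSeries m, (⊤ : Subgroup G).lowerCentralSeries n⁆ ≤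
      (⊤ : Subgroup G).lowerCentralSeries (m + n + 1) := by
  induction n with
  | zero => intro m; rfl
  | succ n ih =>
    intro m
    -- The three subgroups lemma, in the quotient by the subgroup on the right.
    let N := (⊤ : Subgroup G).lowerCentralSeries (m + (n + 1) + 1)
    have hbot : ∀ K : Subgroup G, K.map (QuotientGroup.mk' N) = ⊥ ↔ K ≤ N := by
      intro K
      rw [Subgroup.map_eq_bot_iff, QuotientGroup.ker_mk']
    rw [Subgroup.commutator_comm, Subgroup.lowerCentralSeries_succ]
    change _ ≤ N
    rw [← hbot, Subgroup.map_commutator, Subgroup.map_commutator]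
    apply Subgroup.commutator_commutator_eq_bot_of_rotate
    · rw [← Subgroup.map_commutator, ← Subgroup.map_commutator, hbot, Subgroup.commutator_comm ⊤]
      refine (ih (m + 1)).trans (le_of_eq ?_)
      simp only [N]
      congr 1
      omega
    · rw [← Subgroup.map_commutator, ← Subgroup.map_commutator, hbot]
      exact Subgroup.commutator_mono (ih m) le_rfl

/-- The shift of index by `1` matches weights; weight `0` gives the whole group, because of the
truncated subtraction. -/
theorem isFiltration_lowerCentralSeries (G : Type*) [Group G] :
    IsFiltration fun n : ℕ => (⊤ : Subgroup G).lowerCentralSeries (n - 1) where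
  zero := rfl
  antitone := fun m n h => Subgroup.lowerCentralSeries_antitone _ (by omega)
  commutator_mem := fun {m n g h} hg hh => by
    have hgh := Subgroup.commutator_mem_commutator hg hh
    rcases Nat.eq_zero_or_pos m with rfl | hm
    · rw [zero_add]
      exact Subgroup.commutator_le_right _ _ hgh
    rcases Nat.eq_zero_or_pos n with rfl | hn
    · exact Subgroup.commutator_le_left _ _ hgh
    · exact Subgroup.lowerCentralSeries_antitone _ (by omega)
        (commutator_lowerCentralSeries_le _ _ hgh)

/-- A filtration starting with the whole group in weight `1` contains the lower central series. -/
theorem IsFiltration.lowerCentralSeries_le {G : Type*} [Group G] {F : ℕ → Subgroup G}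
    (hF : IsFiltration F) (h1 : F 1 = ⊤) (n : ℕ) :
    (⊤ : Subgroup G).lowerCentralSeries n ≤ F (n + 1) := by
  induction n with
  | zero => rw [h1]; exact le_top
  | succ n ih =>
    exact Subgroup.commutator_le.mpr fun g hg h hh =>
      hF.commutator_mem (ih hg) (by rw [h1]; trivial)

/-! ### Shears of free groups given by a partial successor function -/

section Shift

variable {d : ℕ} {next : Fin d → Option (Fin d)}

/-- The endomorphism `x_i ↦ x_i * x_(next i)` of the free group, where `x_(next i)` is read as `1`
if `next i` is undefined. -/
def shift (next : Fin d → Option (Fin d)) : FreeGroup (Fin d) →* FreeGroup (Fin d) :=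
  FreeGroup.lift fun i => FreeGroup.of i * (next i).elim 1 FreeGroup.of

/-- The preimage of `x_i` under `shift next`, which is `x_i` times the inverse of the preimage of
`x_(next i)`. -/
def shiftInvGen (hnext : ∀ i k, next i = some k → i < k) (i : Fin d) : FreeGroup (Fin d) :=
  match _h : next i with
  | none => FreeGroup.of i
  | some k => FreeGroup.of i * (shiftInvGen hnext k)⁻¹
termination_by d - i.val
decreasing_by
  have := hnext i k _h
  omega

theorem shiftInvGen_of_none (hnext : ∀ i k, next i = some k → i < k) {i : Fin d}
    (h : next i = none) : shiftInvGen hnext i = FreeGroup.of i := by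
  rw [shiftInvGen]
  split
  · rfl
  · simp_all

theorem shiftInvGen_of_some (hnext : ∀ i k, next i = some k → i < k) {i k : Fin d}
    (h : next i = some k) :
    shiftInvGen hnext i = FreeGroup.of i * (shiftInvGen hnext k)⁻¹ := by
  rw [shiftInvGen]
  split
  · simp_all
  · rename_i k' h'
    rw [h] at h'
    cases h'
    rfl

theorem shift_shiftInvGen (hnext : ∀ i k, next i = some k → i < k) (i : Fin d) :
    shift next (shiftInvGen hnext i) = FreeGroup.of i := by
  induction i using WellFoundedGT.induction with
  | ind i ih =>
    rcases h : next i with _ | k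
    · rw [shiftInvGen_of_none hnext h]
      simp [shift, h]
    · rw [shiftInvGen_of_some hnext h, map_mul, map_inv, ih k (hnext i k h)]
      simp [shift, h]

/-- `shift next` as an automorphism: `next` strictly increases, so it can be inverted by downward
recursion on the index. -/
def shiftEquiv (hnext : ∀ i k, next i = some k → i < k) : MulAut (FreeGroup (Fin d)) :=
  MonoidHom.toMulEquiv (shift next) (FreeGroup.lift (shiftInvGen hnext))
    (by
      ext i
      rcases h : next i with _ | k
      · simp [shift, h, shiftInvGen_of_none hnext h]
      · simp [shift, h, shiftInvGen_of_some hnext h])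
    (by
      ext i
      simp [shift_shiftInvGen])

variable {M : Type*} [AddCommMonoid M] [PartialOrder M] [IsOrderedAddMonoid M]
  [CanonicallyOrderedAdd M] {w : Fin d → M} {c : M}

theorem isShear_shiftEquiv (hnext : ∀ i k, next i = some k → i < k)
    (hw : ∀ i k, next i = some k → w k = w i + c) :
    IsShear (weightSubgroup w) c (shiftEquiv hnext) := by
  refine isShear_of_generators (shift next) fun i => ?_
  rcases h : next i with _ | k
  · simp [shift, h, one_mem]
  · simpa [shift, h, ← hw i k h] using of_mem_weightSubgroup k

theorem shiftInvGen_mem_weightSubgroup (hnext : ∀ i k, next i = some k → i < k)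
    (hw : ∀ i k, next i = some k → w k = w i + c) (i : Fin d) :
    shiftInvGen hnext i ∈ weightSubgroup w (w i) := by
  induction i using WellFoundedGT.induction with
  | ind i ih =>
    rcases h : next i with _ | k
    · rw [shiftInvGen_of_none hnext h]
      exact of_mem_weightSubgroup i
    · rw [shiftInvGen_of_some hnext h]
      have hk := ih k (hnext i k h)
      rw [hw i k h] at hk
      exact mul_mem (of_mem_weightSubgroup i) (inv_mem
        (isFiltration_weightSubgroup.antitone (le_add_of_nonneg_right zero_le) hk))

theorem isShear_shiftEquiv_inv (hnext : ∀ i k, next i = some k → i < k)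
    (hw : ∀ i k, next i = some k → w k = w i + c) :
    IsShear (weightSubgroup w) c ((shiftEquiv hnext)⁻¹ : MulAut (FreeGroup (Fin d))) := by
  refine isShear_of_generators (FreeGroup.lift (shiftInvGen hnext)) fun i => ?_
  rcases h : next i with _ | k
  · simp [shiftInvGen_of_none hnext h, one_mem]
  · have := inv_mem (shiftInvGen_mem_weightSubgroup hnext hw k)
    rw [hw i k h] at this
    simpa [shiftInvGen_of_some hnext h] using this

/-- The action of the integers on the free group in which conjugation by the inverse of the
generator is `shiftEquiv`. -/
def shiftAction (hnext : ∀ i k, next i = some k → i < k) :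
    Multiplicative ℤ →* MulAut (FreeGroup (Fin d)) :=
  zpowersHom _ (shiftEquiv hnext)⁻¹

theorem isShear_shiftAction (hnext : ∀ i k, next i = some k → i < k)
    (hw : ∀ i k, next i = some k → w k = w i + c) (k : Multiplicative ℤ) :
    IsShear (weightSubgroup w) c (shiftAction hnext k) := by
  rw [shiftAction, zpowersHom_apply]
  exact IsShear.zpow isFiltration_weightSubgroup (isShear_shiftEquiv_inv hnext hw)
    (by rw [inv_inv]; exact isShear_shiftEquiv hnext hw) _

theorem shiftAction_ofAdd_one_inv (hnext : ∀ i k, next i = some k → i < k) :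
    shiftAction hnext (Multiplicative.ofAdd 1)⁻¹ = shiftEquiv hnext := by
  simp [shiftAction, zpowersHom_apply]

end Shift

/-! ### Lists of basic commutators -/

open FormalComm

namespace FormalComm

variable {r : ℕ}

theorem totalWeight_bracket (α β : FormalComm r) :
    (bracket α β).totalWeight = α.totalWeight + β.totalWeight := by
  simp [totalWeight, weight, Finset.sum_add_distrib]

@[simp] theorem totalWeight_letter (a : Fin r) : (letter a).totalWeight = 1 := by
  simp [totalWeight, weight]

@[simp] theorem totalWeight_letterInv (a : Fin r) : (letterInv a).totalWeight = 1 := by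
  simp [totalWeight, weight]

theorem totalWeight_pos (α : FormalComm r) : 0 < α.totalWeight := by
  induction α with
  | letter i => simp
  | letterInv i => simp
  | bracket α β _ _ => rw [totalWeight_bracket]; omega

theorem weight_bracket (α β : FormalComm r) : (bracket α β).weight = α.weight + β.weight := rfl

theorem finite_totalWeight_le (r s : ℕ) : {α : FormalComm r | α.totalWeight ≤ s}.Finite := by
  induction s with
  | zero =>
    convert Set.finite_empty
    ext α
    have := totalWeight_pos α
    simp
    omega
  | succ s ih =>
    refine (((Set.finite_range letter).union (Set.finite_range letterInv)).union
      (Set.Finite.image2 bracket ih ih)).subset ?_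
    rintro (i | i | ⟨α, β⟩) h
    · exact Or.inl (Or.inl ⟨i, rfl⟩)
    · exact Or.inl (Or.inr ⟨i, rfl⟩)
    · have ha := totalWeight_pos α
      have hb := totalWeight_pos β
      simp only [Set.mem_ofPred_eq, totalWeight_bracket] at h
      exact Or.inr ⟨α, by simp only [Set.mem_ofPred_eq]; omega, β,
        by simp only [Set.mem_ofPred_eq]; omega, rfl⟩

theorem map_comm {G Q : Type*} [Group G] [Group Q] (f : G →* Q) (a b : G) :
    f (comm a b) = comm (f a) (f b) := by
  simp [comm]

theorem map_eval {G Q : Type*} [Group G] [Group Q] (f : G →* Q) (x : Fin r → G)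
    (α : FormalComm r) : f (α.eval x) = α.eval fun a => f (x a) := by
  induction α with
  | letter i => rfl
  | letterInv i => simp [eval]
  | bracket α β iha ihb => rw [eval, map_comm, iha, ihb]; rfl

/-- The value of a formal commutator lies in the term of its own weight. The homomorphism `wt`
allows weights coarser than the weight vector, such as the total weight. -/
theorem eval_mem {M G : Type*} [AddCommMonoid M] [PartialOrder M] [Group G]
    {F : M → Subgroup G} (hF : IsFiltration F) {wt : (Fin r → ℕ) →+ M} {x : Fin r → G}
    (hx : ∀ a, x a ∈ F (wt (letter a).weight)) (α : FormalComm r) :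
    α.eval x ∈ F (wt α.weight) := by
  induction α with
  | letter i => exact hx i
  | letterInv i => exact inv_mem (hx i)
  | bracket α β iha ihb =>
    rw [weight_bracket, map_add]
    exact hF.comm_mem iha ihb

theorem eval_eq_one {G : Type*} [Group G] {s : ℕ} (hG : IsStepNilpotent s G) (x : Fin r → G)
    {α : FormalComm r} (hα : s < α.totalWeight) : α.eval x = 1 := by
  let wt : (Fin r → ℕ) →+ ℕ :=
    { toFun := fun f => ∑ i, f i
      map_zero' := by simp
      map_add' := fun f g => by simp [Finset.sum_add_distrib] }
  have h := eval_mem (wt := wt) (x := x) (isFiltration_lowerCentralSeries G)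
    (fun a => by
      have h1 : wt (letter a).weight = 1 := totalWeight_letter a
      rw [h1]
      trivial) α
  have h2 := Subgroup.lowerCentralSeries_antitone (⊤ : Subgroup G)
    (show s ≤ wt α.weight - 1 from Nat.le_sub_one_of_lt hα) h
  rw [IsStepNilpotent] at hG
  rw [hG] at h2
  simpa using h2

end FormalComm

namespace IsBasicCommList

variable {r s d : ℕ} {u : Fin d → FormalComm r}

theorem totalWeight_le (hu : IsBasicCommList r s u) (i : Fin d) : (u i).totalWeight ≤ s :=
  ((hu.mem_iff (u i)).mp ⟨i, rfl⟩).1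

theorem lt_of_totalWeight_lt (hu : IsBasicCommList r s u) {i j : Fin d}
    (h : (u i).totalWeight < (u j).totalWeight) : i < j := by
  by_contra hij
  have := hu.totalWeight_mono j i (not_lt.mp hij)
  omega

theorem lt_of_bracket (hu : IsBasicCommList r s u) {i p t : Fin d}
    (h : u i = bracket (u p) (u t)) : p < i ∧ t < p ∧ ∀ a b, u p = bracket (u a) (u b) → b ≤ t := by
  have hw := totalWeight_bracket (u p) (u t)
  rw [← h] at hw
  have ht := totalWeight_pos (u t)
  refine ⟨hu.lt_of_totalWeight_lt (by omega), ?_⟩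
  rcases ((hu.mem_iff (u i)).mp ⟨i, rfl⟩).2 with ⟨a, ha⟩ | ⟨p', t', h', hlt, hc⟩
  · rw [h] at ha
    cases ha
  · rw [h] at h'
    injection h' with h1 h2
    cases hu.injective h1
    cases hu.injective h2
    exact ⟨hlt, hc⟩

theorem letter_or_bracket (hu : IsBasicCommList r s u) (i : Fin d) :
    (∃ a, u i = letter a) ∨ ∃ p t, u i = bracket (u p) (u t) := by
  rcases ((hu.mem_iff (u i)).mp ⟨i, rfl⟩).2 with h | ⟨p, t, h, _, _⟩
  · exact Or.inl h
  · exact Or.inr ⟨p, t, h⟩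

end IsBasicCommList

section Elimination

variable {r d : ℕ}

/-- The letters left after eliminating `u_0, …, u_(j-1)`: the indices `i ≥ j` for which `u i` is a
letter or a bracket whose right entry has been eliminated. -/
def IsFreeLetter (u : Fin d → FormalComm r) (j : ℕ) (i : Fin d) : Prop :=
  j ≤ i ∧ ∀ p t, u i = bracket (u p) (u t) → t.val < j

open Classical in
/-- The index of `[u i, u j]` in the list, if it occurs there. -/
noncomputable def bracketIndex (u : Fin d → FormalComm r) (j i : Fin d) : Option (Fin d) :=
  if h : ∃ k, u k = bracket (u i) (u j) then some h.choose else none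

variable {u : Fin d → FormalComm r} {s : ℕ}

theorem eq_bracket_of_bracketIndex {j i k : Fin d} (h : bracketIndex u j i = some k) :
    u k = bracket (u i) (u j) := by
  unfold bracketIndex at h
  split_ifs at h with hk
  cases h
  exact hk.choose_spec

theorem ne_bracket_of_bracketIndex {j i : Fin d} (h : bracketIndex u j i = none) (k : Fin d) :
    u k ≠ bracket (u i) (u j) := by
  unfold bracketIndex at h
  split_ifs at h with hk
  exact fun h' => hk ⟨k, h'⟩

theorem bracketIndex_eq_some (hu : IsBasicCommList r s u) {j i k : Fin d}
    (h : u k = bracket (u i) (u j)) : bracketIndex u j i = some k := by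
  rcases h' : bracketIndex u j i with _ | k'
  · exact absurd h (ne_bracket_of_bracketIndex h' k)
  · rw [hu.injective ((eq_bracket_of_bracketIndex h').trans h.symm)]

theorem lt_of_bracketIndex (hu : IsBasicCommList r s u) (j : Fin d) :
    ∀ i k, bracketIndex u j i = some k → i < k :=
  fun _ _ h => (hu.lt_of_bracket (eq_bracket_of_bracketIndex h)).1

/-- Hall's condition on `[u i, u j]` says exactly that `u i` is one of the letters left after the
elimination of `u j`. -/
theorem isFreeLetter_of_bracket (hu : IsBasicCommList r s u) {i j k : Fin d}
    (h : u k = bracket (u i) (u j)) :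
    IsFreeLetter u (j + 1) i ∧ IsFreeLetter u (j + 1) k := by
  obtain ⟨h1, h2, h3⟩ := hu.lt_of_bracket h
  refine ⟨⟨h2, fun p t hpt => Nat.lt_succ_of_le (h3 p t hpt)⟩, ⟨h2.trans h1, fun p t hpt => ?_⟩⟩
  rw [h] at hpt
  injection hpt with _ hj
  rw [hu.injective hj]
  exact Nat.lt_succ_self _

theorem isFreeLetter_self (hu : IsBasicCommList r s u) (j : Fin d) : IsFreeLetter u j j :=
  ⟨le_rfl, fun _ _ h => let h' := hu.lt_of_bracket h; h'.2.1.trans h'.1⟩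

theorem IsFreeLetter.succ {i j : Fin d} (h : IsFreeLetter u j i) (hij : i ≠ j) :
    IsFreeLetter u (j + 1) i :=
  ⟨lt_of_le_of_ne h.1 fun h' => hij (Fin.ext h'.symm), fun p t hpt => (h.2 p t hpt).trans
    (Nat.lt_succ_self _)⟩

theorem totalWeight_lt_of_bracketIndex (hu : IsBasicCommList r s u) {j i : Fin d}
    (hi : IsFreeLetter u (j + 1) i) (h : bracketIndex u j i = none) :
    s < (bracket (u i) (u j)).totalWeight := by
  by_contra hs
  have : bracket (u i) (u j) ∈ Set.range u := (hu.mem_iff _).mpr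
    ⟨not_lt.mp hs, Or.inr ⟨i, j, rfl, hi.1, fun p t hpt => Nat.le_of_lt_succ (hi.2 p t hpt)⟩⟩
  obtain ⟨k, hk⟩ := this
  exact ne_bracket_of_bracketIndex h k hk

/-- The group after eliminating `u_j`: the free group on the remaining letters, extended by an
infinite cyclic group whose generator stands for `u_j` and acts by `u_i ↦ u_i [u_i, u_j]`. -/
abbrev ElimGroup (hu : IsBasicCommList r s u) (j : Fin d) : Type :=
  FreeGroup (Fin d) ⋊[shiftAction (lt_of_bracketIndex hu j)] Multiplicative ℤ

/-- The element of `ElimGroup hu j` standing for `u_j`. -/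
noncomputable def elimGen (hu : IsBasicCommList r s u) (j : Fin d) : ElimGroup hu j :=
  SemidirectProduct.inr (Multiplicative.ofAdd 1)

open Classical in
/-- The elimination of the letter `u_j`. Only the generators whose index is a free letter matter;
the others are sent to `1`. -/
noncomputable def elim (hu : IsBasicCommList r s u) (j : Fin d) :
    FreeGroup (Fin d) →* ElimGroup hu j :=
  FreeGroup.lift fun i => if i = j then elimGen hu j else
    if IsFreeLetter u j i then SemidirectProduct.inl (FreeGroup.of i) else 1

/-- When `u_j` is eliminated, a bracket `[u_i, u_j]` becomes a generator, or `1` if it is not in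
the list. -/
theorem comm_inl_elimGen (hu : IsBasicCommList r s u) (j i : Fin d) :
    comm (SemidirectProduct.inl (FreeGroup.of i)) (elimGen hu j) =
      SemidirectProduct.inl ((bracketIndex u j i).elim 1 FreeGroup.of) := by
  have h := SemidirectProduct.inl_aut (φ := shiftAction (lt_of_bracketIndex hu j))
    (Multiplicative.ofAdd 1)⁻¹ (FreeGroup.of i)
  rw [shiftAction_ofAdd_one_inv] at h
  change SemidirectProduct.inl (shift (bracketIndex u j) (FreeGroup.of i)) = _ at h
  rw [inv_inv, shift, FreeGroup.lift_apply_of, map_mul] at h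
  rw [eq_inv_mul_of_mul_eq h, comm, elimGen, map_inv]
  group

/-- Elimination respects weights, and `u_j` itself is needed only in weights up to `w j`. -/
theorem elim_of_mem (hu : IsBasicCommList r s u) (j : Fin d) {M : Type*} [AddCommMonoid M]
    [PartialOrder M] [IsOrderedAddMonoid M] [CanonicallyOrderedAdd M] {w : Fin d → M}
    (hw : ∀ i j k, u k = bracket (u i) (u j) → w k = w i + w j) {m : M} {g : FreeGroup (Fin d)}
    (hg : g ∈ weightSubgroup w m) :
    (elim hu j g).left ∈ weightSubgroup w m ∧ ((elim hu j g).right ≠ 1 → m ≤ w j) := by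
  have hφ := isShear_shiftAction (w := w) (c := w j) (lt_of_bracketIndex hu j)
    fun i k h => hw i j k (eq_bracket_of_bracketIndex h)
  refine map_mem_of_mem_weightSubgroup
    (isFiltration_semidirectFiltration isFiltration_weightSubgroup hφ) (elim hu j) (fun i => ?_) hg
  simp only [elim, FreeGroup.lift_apply_of]
  split_ifs with h1 h2
  · subst h1
    exact ⟨one_mem _, fun _ => le_rfl⟩
  · exact ⟨of_mem_weightSubgroup i, fun h => absurd rfl h⟩
  · exact one_mem _

end Elimination

/-! ### Tails of ordered products -/

section TailProd

variable {G : Type*} [Group G] {d : ℕ}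

/-- The product of the entries with index at least `j`. -/
def tailProd (f : Fin d → G) (j : ℕ) : G := ((List.ofFn f).drop j).prod

theorem tailProd_zero (u : Fin d → G) (l : Fin d → ℤ) :
    tailProd (fun i => u i ^ l i) 0 = orderedProd u l := rfl

theorem tailProd_of_le (f : Fin d → G) {j : ℕ} (hj : d ≤ j) : tailProd f j = 1 := by
  rw [tailProd, List.drop_eq_nil_of_le (by simpa using hj), List.prod_nil]

theorem tailProd_eq_mul (f : Fin d → G) (j : Fin d) :
    tailProd f j = f j * tailProd f (j + 1) := by
  rw [tailProd, List.drop_eq_getElem_cons (by simp), List.prod_cons, tailProd]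
  simp

theorem tailProd_congr {f g : Fin d → G} {j : ℕ} (h : ∀ i : Fin d, j ≤ i → f i = g i) :
    tailProd f j = tailProd g j := by
  unfold tailProd
  congr 1
  refine List.ext_getElem (by simp) fun n h1 h2 => ?_
  simpa using h _ (by simp)

theorem map_tailProd {Q : Type*} [Group Q] (φ : G →* Q) (f : Fin d → G) (j : ℕ) :
    φ (tailProd f j) = tailProd (fun i => φ (f i)) j := by
  rw [tailProd, map_list_prod, List.map_drop, List.map_ofFn]
  rfl

theorem tailProd_zero_eq {f : Fin d → G} {j : ℕ} (h : ∀ i : Fin d, i < j → f i = 1) :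
    tailProd f 0 = tailProd f j := by
  rw [tailProd, List.drop_zero, ← List.prod_take_mul_prod_drop _ j, List.prod_eq_one, one_mul,
    tailProd]
  intro a ha
  obtain ⟨n, hn, rfl⟩ := List.getElem_of_mem ha
  simp only [List.getElem_take, List.getElem_ofFn]
  simp only [List.length_take, List.length_ofFn, lt_min_iff] at hn
  exact h _ hn.1

theorem tailProd_eq_orderedProd_tailAfter (u : Fin d → G) (l : Fin d → ℤ) (j : Fin d) :
    tailProd (fun i => u i ^ l i) (j + 1) = orderedProd (tailAfter u j) (tailAfter l j) := by
  unfold tailProd orderedProd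
  congr 1
  refine List.ext_getElem (by simp) fun n h1 h2 => ?_
  simp [tailAfter]

end TailProd

/-! ### Existence of the normal form -/

section Existence

variable {r s d : ℕ} {u : Fin d → FormalComm r}

/-- Coordinates in the group obtained by eliminating `u_j`, the power of `u_j` being on the left as
in the ordered product. -/
theorem exists_elim_eq (hu : IsBasicCommList r s u) (j : Fin d) {M : Type*} [AddCommMonoid M]
    [PartialOrder M] [IsOrderedAddMonoid M] [CanonicallyOrderedAdd M] {w : Fin d → M}
    (hw : ∀ i j k, u k = bracket (u i) (u j) → w k = w i + w j) {m : M} {g : FreeGroup (Fin d)}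
    (hg : g ∈ weightSubgroup w m) :
    ∃ (a : ℤ) (h : FreeGroup (Fin d)), h ∈ weightSubgroup w m ∧ (a ≠ 0 → m ≤ w j) ∧
      elim hu j g = elimGen hu j ^ a * SemidirectProduct.inl h := by
  obtain ⟨h1, h2⟩ := elim_of_mem hu j hw hg
  have hφ := isShear_shiftAction (w := w) (c := w j) (lt_of_bracketIndex hu j)
    fun i k h => hw i j k (eq_bracket_of_bracketIndex h)
  refine ⟨(elim hu j g).right.toAdd, shiftAction (lt_of_bracketIndex hu j) (elim hu j g).right⁻¹
    (elim hu j g).left, (hφ _).map_mem isFiltration_weightSubgroup h1, fun h => h2 fun h' => h ?_,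
    ?_⟩
  · simp [h']
  · rw [SemidirectProduct.inl_aut, elimGen, ← map_zpow, ← ofAdd_zsmul]
    simp [← mul_assoc]

open Classical in
/-- The interpretation in `G` of the free letters left after eliminating `u_0, …, u_(j-1)`. -/
noncomputable def elimEval {G : Type*} [Group G] (u : Fin d → FormalComm r) (x : Fin r → G)
    (j : ℕ) : FreeGroup (Fin d) →* G :=
  FreeGroup.lift fun i => if IsFreeLetter u j i then (u i).eval x else 1

variable {G : Type*} [Group G]

/-- The action of `u_j` on the remaining letters becomes conjugation in `G`: where the bracket
`[u_i, u_j]` is not in the list its total weight exceeds `s`, hence it is trivial in `G`. -/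
theorem elimEval_shift (hu : IsBasicCommList r s u) (hG : IsStepNilpotent s G) (x : Fin r → G)
    (j : Fin d) (g : FreeGroup (Fin d)) :
    elimEval u x (j + 1) (shift (bracketIndex u j) g) =
      ((u j).eval x)⁻¹ * elimEval u x (j + 1) g * (u j).eval x := by
  suffices h : (elimEval u x (j + 1)).comp (shift (bracketIndex u j)) =
      (MulAut.conj ((u j).eval x)⁻¹).toMonoidHom.comp (elimEval u x (j + 1)) by
    simpa using DFunLike.congr_fun h g
  ext i
  simp only [MonoidHom.comp_apply, shift, FreeGroup.lift_apply_of, map_mul,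
    MulEquiv.coe_toMonoidHom, MulAut.conj_apply, inv_inv]
  rcases h : bracketIndex u j i with _ | k
  · rw [Option.elim_none, map_one, mul_one]
    simp only [elimEval, FreeGroup.lift_apply_of]
    split_ifs with hi
    · have h1 := eval_eq_one hG x (totalWeight_lt_of_bracketIndex hu hi h)
      rw [eval, comm, mul_assoc, mul_assoc, inv_mul_eq_one] at h1
      rw [mul_assoc, ← h1]
    · simp
  · have hk := eq_bracket_of_bracketIndex h
    obtain ⟨hi', hk'⟩ := isFreeLetter_of_bracket hu hk
    simp only [Option.elim_some, elimEval, FreeGroup.lift_apply_of, if_pos hi', if_pos hk', hk,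
      eval, comm]
    group

/-- Compatibility of the two factors of `ElimGroup hu j` with their interpretations in `G`, as
needed to map the semidirect product to `G`. -/
theorem elimEval_shiftAction (hu : IsBasicCommList r s u) (hG : IsStepNilpotent s G)
    (x : Fin r → G) (j : Fin d) (k : Multiplicative ℤ) :
    (elimEval u x (j + 1)).comp (shiftAction (lt_of_bracketIndex hu j) k).toMonoidHom =
      (MulAut.conj (zpowersHom G ((u j).eval x) k)).toMonoidHom.comp (elimEval u x (j + 1)) := by
  have h1 : ∀ g, elimEval u x (j + 1) (shiftEquiv (lt_of_bracketIndex hu j) g) =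
      ((u j).eval x)⁻¹ * elimEval u x (j + 1) g * (u j).eval x := elimEval_shift hu hG x j
  have h2 : ∀ g, elimEval u x (j + 1) ((shiftEquiv (lt_of_bracketIndex hu j))⁻¹ g) =
      (u j).eval x * elimEval u x (j + 1) g * ((u j).eval x)⁻¹ := by
    intro g
    have := h1 ((shiftEquiv (lt_of_bracketIndex hu j))⁻¹ g)
    rw [MulAut.apply_inv_self] at this
    rw [this]
    group
  ext i
  simp only [MonoidHom.comp_apply, MulEquiv.coe_toMonoidHom, MulAut.conj_apply, shiftAction,
    zpowersHom_apply]
  generalize FreeGroup.of i = g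
  induction k.toAdd using Int.induction_on generalizing g with
  | zero => simp
  | succ n ih =>
    rw [zpow_add_one, MulAut.mul_apply, ih, h2, zpow_add_one, mul_inv_rev]
    simp only [mul_assoc]
  | pred n ih =>
    rw [zpow_sub_one, inv_inv, MulAut.mul_apply, ih, h1, zpow_sub_one, mul_inv_rev, inv_inv]
    simp only [mul_assoc]

/-- Eliminating `u_j` splits off a power of the value of `u_j` in `G` on the left. -/
theorem elimEval_eq_of_elim_eq (hu : IsBasicCommList r s u) (hG : IsStepNilpotent s G)
    (x : Fin r → G) (j : Fin d) {g h : FreeGroup (Fin d)} {a : ℤ}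
    (hg : elim hu j g = elimGen hu j ^ a * SemidirectProduct.inl h) :
    elimEval u x j g = (u j).eval x ^ a * elimEval u x (j + 1) h := by
  let θ : ElimGroup hu j →* G := SemidirectProduct.lift (elimEval u x (j + 1))
    (zpowersHom G ((u j).eval x)) (elimEval_shiftAction hu hG x j)
  have hθ : θ.comp (elim hu j) = elimEval u x j := by
    ext i
    simp only [MonoidHom.comp_apply, elim, elimEval, FreeGroup.lift_apply_of]
    by_cases hij : i = j
    · subst hij
      simp [θ, elimGen, isFreeLetter_self hu]
    · rw [if_neg hij]
      split_ifs with hi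
      · simp [θ, elimEval, hi.succ hij]
      · exact map_one θ
  rw [← hθ, MonoidHom.comp_apply, hg, map_mul, map_zpow]
  simp [θ, elimGen]

/-- The normal form of an element of the free group on the letters left at stage `j`. The exponents
do not depend on the nilpotent group in which the normal form is read. -/
theorem exists_elimEval_eq_tailProd.{v} (hu : IsBasicCommList r s u) (k : ℕ) :
    ∀ (j : ℕ), j + k = d → ∀ (m : Fin r → ℕ) (g : FreeGroup (Fin d)),
      g ∈ weightSubgroup (fun i => (u i).weight) m →
      ∃ l : Fin d → ℤ, (∀ i, l i ≠ 0 → m ≤ (u i).weight) ∧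
        ∀ (G : Type v) [Group G], IsStepNilpotent s G → ∀ x : Fin r → G,
          elimEval u x j g = tailProd (fun i => (u i).eval x ^ l i) j := by
  induction k with
  | zero =>
    intro j hj m g _
    refine ⟨0, fun i h => absurd rfl h, fun G _ _ x => ?_⟩
    rw [tailProd_of_le _ (by omega)]
    suffices elimEval u x j = 1 by rw [this, MonoidHom.one_apply]
    ext i
    have hi : ¬ IsFreeLetter u j i := fun h => by
      have := h.1
      omega
    simp [elimEval, hi]
  | succ k ih =>
    intro j hj m g hg
    obtain ⟨j, rfl⟩ : ∃ j' : Fin d, j'.val = j := ⟨⟨j, by omega⟩, rfl⟩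
    obtain ⟨a, h, hh, ha, hgh⟩ := exists_elim_eq hu j
      (fun i j k hk => by rw [hk, weight_bracket]) hg
    obtain ⟨l, hl, hlG⟩ := ih (j + 1) (by omega) m h hh
    refine ⟨Function.update l j a, fun i hi => ?_, fun G _ hG x => ?_⟩
    · by_cases hij : i = j
      · subst hij
        rw [Function.update_self] at hi
        exact ha hi
      · rw [Function.update_of_ne hij] at hi
        exact hl i hi
    · rw [elimEval_eq_of_elim_eq hu hG x j hgh, hlG G hG x, tailProd_eq_mul, Function.update_self]
      congr 1
      refine tailProd_congr fun i hi => ?_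
      rw [Function.update_of_ne]
      rintro rfl
      omega

open Classical in
/-- The generator standing for the letter `a`. It exists unless `s = 0`. -/
noncomputable def letterGen (u : Fin d → FormalComm r) (a : Fin r) : FreeGroup (Fin d) :=
  if h : ∃ i, u i = letter a then FreeGroup.of h.choose else 1

theorem letterGen_mem {M : Type*} [AddCommMonoid M] [PartialOrder M] {w : FormalComm r → M}
    (a : Fin r) : letterGen u a ∈ weightSubgroup (fun i => w (u i)) (w (letter a)) := by
  unfold letterGen
  split_ifs with h
  · have := of_mem_weightSubgroup (w := fun i => w (u i)) h.choose
    rwa [h.choose_spec] at this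
  · exact one_mem _

theorem elimEval_letterGen (hu : IsBasicCommList r s u) (hG : IsStepNilpotent s G)
    (x : Fin r → G) (a : Fin r) : elimEval u x 0 (letterGen u a) = x a := by
  unfold letterGen
  split_ifs with h
  · have hi := h.choose_spec
    have hf : IsFreeLetter u 0 h.choose := ⟨Nat.zero_le _, fun p t hpt => by
      rw [hi] at hpt
      cases hpt⟩
    simp only [elimEval, FreeGroup.lift_apply_of, if_pos hf]
    rw [hi, eval]
  · have hs : s < (letter a).totalWeight := by
      by_contra hs
      exact h ((hu.mem_iff (letter a)).mpr ⟨not_lt.mp hs, Or.inl ⟨a, rfl⟩⟩)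
    rw [map_one]
    exact (eval_eq_one hG x hs).symm

theorem elimEval_eval_letterGen (hu : IsBasicCommList r s u) (hG : IsStepNilpotent s G)
    (x : Fin r → G) (α : FormalComm r) :
    elimEval u x 0 (α.eval (letterGen u)) = α.eval x := by
  rw [map_eval]
  congr 1
  funext a
  exact elimEval_letterGen hu hG x a

theorem eval_letterGen_mem (α : FormalComm r) :
    α.eval (letterGen u) ∈ weightSubgroup (fun i => (u i).weight) α.weight :=
  eval_mem (wt := AddMonoidHom.id _) isFiltration_weightSubgroup
    (fun a => letterGen_mem (w := weight) a) α

theorem exists_eval_eq_orderedProd.{v} (hu : IsBasicCommList r s u) (α : FormalComm r) :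
    ∃ l : Fin d → ℤ, (∀ i, l i ≠ 0 → α.weight ≤ (u i).weight) ∧
      ∀ (G : Type v) [Group G], IsStepNilpotent s G → ∀ x : Fin r → G,
        α.eval x = orderedProd (fun i => (u i).eval x) l := by
  obtain ⟨l, hl, h⟩ := exists_elimEval_eq_tailProd hu d 0 (zero_add d) α.weight _
    (eval_letterGen_mem α)
  refine ⟨l, hl, fun G _ hG x => ?_⟩
  rw [← tailProd_zero, ← h G hG x, elimEval_eval_letterGen hu hG]

theorem exists_comm_zpow_eq_tailProd.{v} (hu : IsBasicCommList r s u) (i j : Fin d) (e f : ℤ) :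
    ∃ l : Fin d → ℤ, (∀ k, l k ≠ 0 → (u i).weight + (u j).weight ≤ (u k).weight) ∧
      ∀ (G : Type v) [Group G], IsStepNilpotent s G → ∀ x : Fin r → G,
        comm ((u i).eval x ^ e) ((u j).eval x ^ f) =
          tailProd (fun k => (u k).eval x ^ l k) (j + 1) := by
  obtain ⟨l, hl, h⟩ := exists_elimEval_eq_tailProd hu d 0 (zero_add d)
    ((u i).weight + (u j).weight) (comm ((u i).eval (letterGen u) ^ e)
      ((u j).eval (letterGen u) ^ f))
    (isFiltration_weightSubgroup.comm_mem (zpow_mem (eval_letterGen_mem _) _)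
      (zpow_mem (eval_letterGen_mem _) _))
  refine ⟨l, hl, fun G _ hG x => ?_⟩
  rw [← tailProd_zero_eq, ← h G hG x, map_comm, map_zpow, map_zpow,
    elimEval_eval_letterGen hu hG, elimEval_eval_letterGen hu hG]
  -- Exponents up to index `j` vanish: those entries have total weight at most that of `u_j`.
  intro k hk
  have : l k = 0 := by
    by_contra hlk
    have h1 : (u i).totalWeight + (u j).totalWeight ≤ (u k).totalWeight := by
      rw [← totalWeight_bracket]
      exact Finset.sum_le_sum fun a _ => hl k hlk a
    have h2 := hu.totalWeight_mono k j (by rw [Fin.le_def]; omega)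
    have h3 := totalWeight_pos (u i)
    omega
  rw [this, zpow_zero]

end Existence

/-! ### Uniqueness of the normal form -/

section Uniqueness

variable {r s d : ℕ} {u : Fin d → FormalComm r}

open Classical in
/-- The value of a formal commutator in the free group on the letters left after eliminating
`u_0, …, u_(j-1)`: brackets that are letters at this stage are read as generators. -/
noncomputable def stageEval (u : Fin d → FormalComm r) (j : ℕ) : FormalComm r → FreeGroup (Fin d)
  | letter a => letterGen u a
  | letterInv a => (letterGen u a)⁻¹
  | bracket α β =>
    if h : ∃ i, IsFreeLetter u j i ∧ u i = bracket α β then FreeGroup.of h.choose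
    else comm (stageEval u j α) (stageEval u j β)

theorem stageEval_of_isFreeLetter (hu : IsBasicCommList r s u) {j : ℕ} {i : Fin d}
    (h : IsFreeLetter u j i) : stageEval u j (u i) = FreeGroup.of i := by
  rcases hu.letter_or_bracket i with ⟨a, ha⟩ | ⟨p, t, hpt⟩
  · have hex : ∃ k, u k = letter a := ⟨i, ha⟩
    rw [ha, stageEval, letterGen, dif_pos hex, hu.injective (hex.choose_spec.trans ha.symm)]
  · have hex : ∃ k, IsFreeLetter u j k ∧ u k = bracket (u p) (u t) := ⟨i, h, hpt⟩
    rw [hpt, stageEval, dif_pos hex, hu.injective (hex.choose_spec.2.trans hpt.symm)]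

theorem stageEval_of_bracket {j : ℕ} {i p t : Fin d}
    (h : u i = bracket (u p) (u t)) (hjt : j ≤ t) :
    stageEval u j (u i) = comm (stageEval u j (u p)) (stageEval u j (u t)) := by
  rw [h, stageEval, dif_neg]
  rintro ⟨k, hk, hk'⟩
  exact absurd (hk.2 p t hk') (not_lt.mpr hjt)

theorem stageEval_zero (hu : IsBasicCommList r s u) (α : FormalComm r) :
    stageEval u 0 α = α.eval (letterGen u) := by
  induction α with
  | letter a => rfl
  | letterInv a => rfl
  | bracket α β iha ihb =>
    rw [stageEval, dif_neg, iha, ihb, eval]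
    rintro ⟨i, hi, h⟩
    rcases hu.letter_or_bracket i with ⟨a, ha⟩ | ⟨p, t, hpt⟩
    · rw [ha] at h
      cases h
    · exact Nat.not_lt_zero _ (hi.2 p t hpt)

theorem elim_stageEval_self (hu : IsBasicCommList r s u) (j : Fin d) :
    elim hu j (stageEval u j (u j)) = elimGen hu j := by
  rw [stageEval_of_isFreeLetter hu (isFreeLetter_self hu j)]
  simp [elim]

/-- Eliminating `u_j` turns the later basic commutators of one stage into those of the next. -/
theorem elim_stageEval (hu : IsBasicCommList r s u) (j i : Fin d) (hij : j < i) :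
    elim hu j (stageEval u j (u i)) = SemidirectProduct.inl (stageEval u (j + 1) (u i)) := by
  induction i using WellFoundedLT.induction with
  | ind i ih =>
    by_cases hi : IsFreeLetter u j i
    · rw [stageEval_of_isFreeLetter hu hi, stageEval_of_isFreeLetter hu (hi.succ hij.ne')]
      simp [elim, hij.ne', hi]
    obtain ⟨p, t, hpt, hjt⟩ : ∃ p t, u i = bracket (u p) (u t) ∧ j ≤ t := by
      by_contra! hcon
      exact hi ⟨hij.le, fun p t hpt => hcon p t hpt⟩
    obtain ⟨hp, ht, -⟩ := hu.lt_of_bracket hpt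
    rw [stageEval_of_bracket hpt hjt, map_comm, ih p hp (hjt.trans_lt ht)]
    rcases hjt.eq_or_lt with rfl | hjt
    · -- The brackets `[u_p, u_j]` become letters when `u_j` is eliminated.
      obtain ⟨hp', hi'⟩ := isFreeLetter_of_bracket hu hpt
      rw [elim_stageEval_self, stageEval_of_isFreeLetter hu hp', stageEval_of_isFreeLetter hu hi',
        comm_inl_elimGen, bracketIndex_eq_some hu hpt, Option.elim_some]
    · rw [ih t (ht.trans hp) hjt, ← map_comm, stageEval_of_bracket hpt hjt]

theorem elim_tailProd (hu : IsBasicCommList r s u) (j : Fin d) (l : Fin d → ℤ) :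
    elim hu j (tailProd (fun i => stageEval u j (u i) ^ l i) j) = elimGen hu j ^ l j *
      SemidirectProduct.inl (tailProd (fun i => stageEval u (j + 1) (u i) ^ l i) (j + 1)) := by
  rw [map_tailProd, map_tailProd, tailProd_eq_mul, map_zpow, elim_stageEval_self]
  congr 1
  refine tailProd_congr fun i hi => ?_
  rw [map_zpow, map_zpow, elim_stageEval hu j i hi]

/-- Ordered products that agree modulo total weight `s + 1` have the same exponents: the first
exponent is the second coordinate after eliminating the first entry. -/
theorem exponents_eq_of_tailProd (hu : IsBasicCommList r s u) (l m : Fin d → ℤ) (k : ℕ) :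
    ∀ j : ℕ, j + k = d →
      (tailProd (fun i => stageEval u j (u i) ^ l i) j)⁻¹ *
        tailProd (fun i => stageEval u j (u i) ^ m i) j ∈
          weightSubgroup (fun i => (u i).totalWeight) (s + 1) →
      ∀ i : Fin d, j ≤ i → l i = m i := by
  induction k with
  | zero =>
    intro j hj _ i hi
    omega
  | succ k ih =>
    intro j hj h i hi
    obtain ⟨j, rfl⟩ : ∃ j' : Fin d, j'.val = j := ⟨⟨j, by omega⟩, rfl⟩
    obtain ⟨h1, h2⟩ := elim_of_mem hu j
      (fun i j k hk => by rw [hk, totalWeight_bracket]) h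
    rw [map_mul, map_inv, elim_tailProd, elim_tailProd] at h1 h2
    have hlm : l j = m j := by
      by_contra hlm
      have := h2 (by
        simp only [elimGen, ← map_zpow, SemidirectProduct.mul_right, SemidirectProduct.inv_right,
          SemidirectProduct.right_inr, SemidirectProduct.right_inl, mul_one, ← ofAdd_zsmul,
          ← ofAdd_neg, ← ofAdd_add]
        rw [Ne, ofAdd_eq_one]
        simp only [smul_eq_mul, mul_one]
        omega)
      have := hu.totalWeight_le j
      omega
    have h3 : ∀ (t : ElimGroup hu j) (a b : FreeGroup (Fin d)),
        (t * SemidirectProduct.inl a)⁻¹ * (t * SemidirectProduct.inl b) =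
          SemidirectProduct.inl (a⁻¹ * b) := by
      intro t a b
      rw [map_mul, map_inv]
      group
    rw [hlm, h3, SemidirectProduct.left_inl] at h1
    rcases hi.eq_or_lt with hij | hij
    · rw [← Fin.ext hij, hlm]
    · exact ih (j + 1) (by omega) h1 i hij

theorem isStepNilpotent_freeNilpotent (r s : ℕ) : IsStepNilpotent s (FreeNilpotent r s) := by
  have h := Subgroup.map_lowerCentralSeries (⊤ : Subgroup (FreeGroup (Fin r)))
    (QuotientGroup.mk' ((⊤ : Subgroup (FreeGroup (Fin r))).lowerCentralSeries s)) s
  rw [Subgroup.map_top_of_surjective _ (QuotientGroup.mk'_surjective _),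
    QuotientGroup.map_mk'_self] at h
  exact h.symm

/-- Ordered products of basic commutators in the free nilpotent group determine their exponents. -/
theorem orderedProd_injective (hu : IsBasicCommList r s u) :
    Function.Injective
      (orderedProd fun i => (u i).eval (FreeNilpotent.gen r s)) := by
  intro l m h
  let N := (⊤ : Subgroup (FreeGroup (Fin r))).lowerCentralSeries s
  let P : (Fin d → ℤ) → FreeGroup (Fin r) := fun l =>
    tailProd (fun i => (u i).eval FreeGroup.of ^ l i) 0
  have hP : ∀ l, QuotientGroup.mk' N (P l) =
      orderedProd (fun i => (u i).eval (FreeNilpotent.gen r s)) l := by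
    intro l
    rw [map_tailProd, ← tailProd_zero]
    congr 1
    funext i
    rw [map_zpow, map_eval]
    rfl
  have hmem : (P l)⁻¹ * P m ∈ N :=
    QuotientGroup.eq.mp ((hP l).trans (h.trans (hP m).symm))
  have hf : ∀ l, FreeGroup.lift (letterGen u) (P l) =
      tailProd (fun i => stageEval u 0 (u i) ^ l i) 0 := by
    intro l
    rw [map_tailProd]
    congr 1
    funext i
    rw [map_zpow, map_eval, stageEval_zero hu]
    simp
  have h1 : weightSubgroup (fun i => (u i).totalWeight) 1 = ⊤ :=
    weightSubgroup_eq_top fun i => totalWeight_pos (u i)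
  have h2 := isFiltration_weightSubgroup.lowerCentralSeries_le h1 s
    (Subgroup.lowerCentralSeries_mono s le_top (Subgroup.map_lowerCentralSeries _
      (FreeGroup.lift (letterGen u)) s ▸ Subgroup.mem_map_of_mem _ hmem))
  rw [map_mul, map_inv, hf, hf] at h2
  funext i
  exact exponents_eq_of_tailProd hu l m d 0 (zero_add d) h2 i (Nat.zero_le _)

end Uniqueness

/-! ### Upper-triangular form -/

section UpperTriangular

variable {r s : ℕ}

theorem nilLength_nonneg (L : Fin r → ℕ) (α : FormalComm r) : 0 ≤ nilLength L α :=
  Finset.prod_nonneg fun _ _ => by positivity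

theorem nilLength_pos {L : Fin r → ℕ} (hL : ∀ a, 0 < L a) (α : FormalComm r) :
    0 < nilLength L α :=
  Finset.prod_pos fun a _ => pow_pos (Nat.cast_pos.mpr (hL a)) _

theorem nilLength_mul_le {L : Fin r → ℕ} (hL : ∀ a, 0 < L a) {α β γ : FormalComm r}
    (h : α.weight + β.weight ≤ γ.weight) :
    nilLength L α * nilLength L β ≤ nilLength L γ := by
  rw [nilLength, nilLength, ← Finset.prod_mul_distrib]
  refine Finset.prod_le_prod (fun _ _ => by positivity) fun a _ => ?_
  rw [← pow_add]
  exact pow_le_pow_right₀ (by exact_mod_cast hL a) (h a)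

theorem IsUpperTriangular.mono {G : Type*} [Group G] {d : ℕ} {C C' : ℝ} (hC : C ≤ C')
    {v : Fin d → G} {L : Fin d → ℝ} (hL : ∀ i, 0 ≤ L i) (h : IsUpperTriangular C v L) :
    IsUpperTriangular C' v L := by
  intro i j hij a ha b hb
  obtain ⟨l, hl, hab⟩ := h i j hij a ha b hb
  refine ⟨l, fun k => (hl k).trans ?_, hab⟩
  exact div_le_div_of_nonneg_right (mul_le_mul_of_nonneg_right hC (hL _))
    (mul_nonneg (hL _) (hL _))

theorem exists_isUpperTriangular.{v} {d : ℕ} {u : Fin d → FormalComm r}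
    (hu : IsBasicCommList r s u) :
    ∃ C : ℝ, ∀ (G : Type v) [Group G], IsStepNilpotent s G →
      ∀ (x : Fin r → G) (L : Fin r → ℕ), (∀ a, 0 < L a) →
        IsUpperTriangular C (fun i => (u i).eval x) fun i => nilLength L (u i) := by
  choose l hl hlG using exists_comm_zpow_eq_tailProd.{v} hu
  let sgn : Bool → ℤ := fun b => cond b 1 (-1)
  obtain ⟨C, hC⟩ := (Set.finite_range fun p : (Fin d × Fin d) × (Bool × Bool) × Fin d =>
    |(l p.1.1 p.1.2 (sgn p.2.1.1) (sgn p.2.1.2) p.2.2 : ℝ)|).bddAbove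
  have hsgn : ∀ {G : Type v} [Group G] {g a : G}, a ∈ ({g, g⁻¹} : Set G) →
      ∃ b, a = g ^ sgn b := by
    rintro G _ g a (rfl | rfl)
    · exact ⟨true, by simp [sgn]⟩
    · exact ⟨false, by simp [sgn]⟩
  refine ⟨C, fun G _ hG x L hL i j _ a ha b hb => ?_⟩
  obtain ⟨e, rfl⟩ := hsgn ha
  obtain ⟨f, rfl⟩ := hsgn hb
  refine ⟨tailAfter (l i j (sgn e) (sgn f)) j, fun k => ?_, ?_⟩
  · simp only [tailAfter]
    generalize (⟨j.val + 1 + k.val, _⟩ : Fin d) = k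
    have h0 : |(l i j (sgn e) (sgn f) k : ℝ)| ≤ C := hC ⟨((i, j), (e, f), k), rfl⟩
    have hCpos := (abs_nonneg _).trans h0
    have hij := mul_pos (nilLength_pos hL (u i)) (nilLength_pos hL (u j))
    by_cases hk : l i j (sgn e) (sgn f) k = 0
    · rw [hk, Int.cast_zero, abs_zero]
      exact div_nonneg (mul_nonneg hCpos (nilLength_nonneg _ _)) hij.le
    · rw [le_div_iff₀ hij]
      exact mul_le_mul h0 (nilLength_mul_le hL (hl i j _ _ k hk)) hij.le hCpos
  · rw [hlG i j _ _ G hG x, tailProd_eq_orderedProd_tailAfter]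

theorem finite_isBasicCommList (r s : ℕ) :
    {p : Σ d, Fin d → FormalComm r | IsBasicCommList r s p.2}.Finite := by
  have hfin := finite_totalWeight_le r s
  have hpi : ∀ d, (Set.pi Set.univ fun _ : Fin d =>
      {α : FormalComm r | α.totalWeight ≤ s}).Finite := fun d => Set.Finite.pi fun _ => hfin
  refine ((Set.finite_Iic hfin.toFinset.card).biUnion
    fun d _ => (hpi d).image (Sigma.mk d)).subset ?_
  rintro ⟨d, u⟩ hu
  refine Set.mem_biUnion (x := d) ?_ ⟨u, fun i _ => hu.totalWeight_le i, rfl⟩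
  have := Finset.card_le_card_of_injOn (s := Finset.univ) (t := hfin.toFinset) u
    (fun i _ => by simpa using hu.totalWeight_le i) hu.injective.injOn
  simpa using this

end UpperTriangular

end NilProg

theorem mainTheorem11 (r s : ℕ) :
    (∃ C : ℝ, 0 < C ∧
      ∀ (G : Type*) [Group G], NilProg.IsStepNilpotent s G →
      ∀ (x : Fin r → G) (L : Fin r → ℕ), (∀ a, 0 < L a) →
      ∀ (d : ℕ) (u : Fin d → NilProg.FormalComm r), NilProg.IsBasicCommList r s u →
        NilProg.IsUpperTriangular C (fun i => (u i).eval x)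
          (fun i => NilProg.nilLength L (u i))) ∧
    (∀ (d : ℕ) (u : Fin d → NilProg.FormalComm r), NilProg.IsBasicCommList r s u →
      ∀ α : NilProg.FormalComm r,
        (∃! l : Fin d → ℤ, α.eval (NilProg.FreeNilpotent.gen r s) =
          NilProg.orderedProd (fun i => (u i).eval (NilProg.FreeNilpotent.gen r s)) l) ∧
        ∀ l : Fin d → ℤ, α.eval (NilProg.FreeNilpotent.gen r s) =
            NilProg.orderedProd (fun i => (u i).eval (NilProg.FreeNilpotent.gen r s)) l →
          ∀ i, l i ≠ 0 → α.weight ≤ (u i).weight) := by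
  constructor
  · choose! C hC using fun (p : Σ d, Fin d → NilProg.FormalComm r)
      (hp : NilProg.IsBasicCommList r s p.2) => NilProg.exists_isUpperTriangular hp
    obtain ⟨B, hB⟩ := ((NilProg.finite_isBasicCommList r s).image C).bddAbove
    refine ⟨max B 1, by positivity, fun G _ hG x L hL d u hu => ?_⟩
    exact (hC ⟨d, u⟩ hu G hG x L hL).mono ((hB ⟨⟨d, u⟩, hu, rfl⟩).trans (le_max_left _ _))
      fun i => NilProg.nilLength_nonneg L (u i)
  · intro d u hu α
    obtain ⟨l, hl, h⟩ := NilProg.exists_eval_eq_orderedProd hu α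
    have hα := h _ (NilProg.isStepNilpotent_freeNilpotent r s) (NilProg.FreeNilpotent.gen r s)
    have huniq : ∀ m : Fin d → ℤ, α.eval (NilProg.FreeNilpotent.gen r s) =
        NilProg.orderedProd (fun i => (u i).eval (NilProg.FreeNilpotent.gen r s)) m → m = l :=
      fun m hm => NilProg.orderedProd_injective hu (hm.symm.trans hα)
    refine ⟨⟨l, hα, huniq⟩, fun m hm => ?_⟩
    rw [huniq m hm]
    exact hl
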